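/- **Theorem.** Let $\mathcal S$ be a random subset of a finite set $\mathcal X=\{x_1,\dots,x_n\}$ that is a determinantal point process with Hermitian kernel $\mathbf K\in\mathbb C^{n\times n}$, i.e. $\mathbb P(T\subseteq\mathcal S)=\det[\mathbf K_T]$ for all $T\subseteq\mathcal X$, where $\mathbf K_T$ is the submatrix of $\mathbf K$ indexed by $T$. Let $m=\mathbb E|\mathcal S|$ and assume $\mathbf K_{ii}\ge\rho\, m/n$ for all $i$, for some $\rho>0$. Let $\mathcal F$ be a set of functions $f:\mathcal X\to\mathbb R$; write $$L(f)=\sum_{i=1}^n f(x_i),\qquad L_{\mathcal S}(f)=\sum_{x_i\in\mathcal S}\frac{f(x_i)}{\mathbf K_{ii}},\qquad \|f\|_\infty=\max_i|f(x_i)|.$$ Assume that, for some $c>0$, $\frac1n|L(f)|\ge c$ for all $f\in\mathcal F$, and let $V\ge\sup_{f\in\mathcal F}\mathrm{Var}\big(n^{-1}L_{\mathcal S}(f)\big)$. There is a universal constant $A>0$ such that the following hold. 1. If $\dim\mathrm{span}_{\mathbb R}(\mathcal F)=D$, then $$\mathbb P\Big(\exists f\in\mathcal F:\Big|\frac{L_{\mathcal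 S}(f)}{L(f)}-1\Big|\ge\varepsilon\Big)\le 2\exp\Big(6D-\frac{c^2\varepsilon^2}{16AV}\Big),\qquad 0\le\varepsilon\le\frac{4A\rho mV}{3c\,\sup_{f\in\mathcal F}\|f\|_\infty}.$$ 2. If $\mathcal F=\{f_\theta:\theta\in\Theta\}$ with $\Theta\subset\mathbb R^D$ bounded, $\|f_\theta-f_{\theta'}\|_\infty\le\ell\|\theta-\theta'\|$ for all $\theta,\theta'\in\Theta$ and some $\ell>0$, and $|\mathcal S|\le Bm$ almost surely for some $B>0$, then there is a constant $C>0$ depending only on $\Theta$ (hence on $D$), $B,\rho,\ell,c$, such that $$\mathbb P\Big(\exists f\in\mathcal F:\Big|\frac{L_{\mathcal S}(f)}{L(f)}-1\Big|\ge\varepsilon\Big)\le 2\exp\Big(CD-D\log\min(\varepsilon,1)-\frac{c^2\varepsilon^2}{16AV}\Big),\qquad 0\le\varepsilon\le\frac{4A\rho mV}{3c\,\sup_{f\in\mathcal F}\|f\|_\infty}.$$ (When $V=0$ or $m=0$ the range is just $\varepsilon=0$, and the claims are then trivial, the fraction $c^2\varepsilon^2/(16AV)$ being read as $0$; for $\varepsilon=0$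 the second bound is trivial too.) -/

import Mathlib

open MeasureTheory ProbabilityTheory

namespace DPPCoreset

/-- `S` is a random subset of the finite set `ι` which is a determinantal point process with
kernel `K` under the probability `P`: for every `T`, one has `P(T ⊆ S) = det K_T`, where `K_T` is
the submatrix of `K` with rows and columns in `T`. -/
structure IsDPP {Ω ι : Type*} [MeasurableSpace Ω] [DecidableEq ι]
    (P : Measure Ω) (S : Ω → Finset ι) (K : Matrix ι ι ℂ) : Prop where
  measurableSet_eq : ∀ T : Finset ι, MeasurableSet {ω | S ω = T}
  prob_subset : ∀ T : Finset ι,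
    ((P.real {ω | T ⊆ S ω} : ℝ) : ℂ) =
      (K.submatrix (fun i : T => (i : ι)) (fun i : T => (i : ι))).det

/-- The expected number of points `E|S|` of a random finite set. -/
noncomputable def expectedSize {Ω ι : Type*} [MeasurableSpace Ω]
    (P : Measure Ω) (S : Ω → Finset ι) : ℝ :=
  ∫ ω, ((S ω).card : ℝ) ∂P

/-- The full loss `L(f) = ∑ x, f x`. -/
noncomputable def loss {ι : Type*} [Fintype ι] (f : ι → ℝ) : ℝ :=
  ∑ i, f i

/-- The estimated loss `L_s(f) = ∑ x ∈ s, f x / K(x,x)`. The diagonal of a Hermitian matrix is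
real, so nothing is lost by taking the real part. -/
noncomputable def estLoss {ι : Type*} (K : Matrix ι ι ℂ) (s : Finset ι) (f : ι → ℝ) : ℝ :=
  ∑ i ∈ s, f i / (K i i).re

/-- The event that some query `f ∈ F` has relative error `|L_S(f) / L(f) - 1| ≥ ε`. -/
def badEvent {Ω ι : Type*} [Fintype ι] (S : Ω → Finset ι) (K : Matrix ι ι ℂ)
    (F : Set (ι → ℝ)) (ε : ℝ) : Set Ω :=
  {ω | ∃ f ∈ F, ε ≤ |estLoss K (S ω) f / loss f - 1|}

/-- The standing assumptions on the process, the queries and the parameters `ρ`, `c`, `V`: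
`S` is a DPP on `n` points with Hermitian kernel `K`; `K_ii ≥ ρ m / n` with `m = E|S|`;
`V ≥ Var (n⁻¹ L_S(f))` and `n⁻¹ |L(f)| ≥ c` for all `f ∈ F`. -/
structure Setting {Ω : Type*} [MeasurableSpace Ω] (P : Measure Ω) {n : ℕ}
    (S : Ω → Finset (Fin n)) (K : Matrix (Fin n) (Fin n) ℂ) (F : Set (Fin n → ℝ))
    (ρ c V : ℝ) : Prop where
  isHermitian : K.IsHermitian
  isDPP : IsDPP P S K
  diag_ge : ∀ i, ρ * expectedSize P S / n ≤ (K i i).re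
  variance_le : ∀ f ∈ F, variance (fun ω => (n : ℝ)⁻¹ * estLoss K (S ω) f) P ≤ V
  loss_ge : ∀ f ∈ F, c ≤ (n : ℝ)⁻¹ * |loss f|

end DPPCoreset

/-! The Laplace functional of the process is a determinant: `E exp(t ∑_{i∈S} g_i) = det(1 +
diag(e^{tg} - 1) K)`. The identity also forces the spectrum of `K` into `[0, 1]`, so `K = Q Qᴴ` with
`Qᴴ Q ≤ 1`, and a unitary change of `Q` makes `Qᴴ diag(g) Q = diag(h)`. By Sylvester's identity the
determinant is that of a positive semidefinite matrix whose `j`-th diagonal entry is the moment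
generating function of a variable equal to `g_i` with probability `|Q_ij|²` and to `0` otherwise.
After centering, `det M ≤ exp(tr M - n)` bounds it through these entries alone, each at most `1 + t²
Var_j`; since `Qᴴ diag(g) Q` is diagonal, the `Var_j` add up to the variance of `∑_{i∈S} g_i`. So
linear statistics are sub-Gaussian near `0` with their own variance as proxy (`mgf_sum_le`), and
Chernoff's bound gives the tail of one query (`prob_abs_sub_ge_le`).

Uniformity over `F` comes from nets and a union bound, the error being linear in `f`. In the first
claim the net lies in the unit ball of a norm on `span F` that combines the sup norm and the
standard deviation, so that every net point obeys the one-query bound. In the second it lies in `Θ`,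
and `|S| ≤ B m` makes the error Lipschitz in `θ`. -/

namespace DPPCoreset

open Matrix
open scoped ComplexOrder

/-! ### Determinant bounds for Hermitian contractions -/

section MatrixAux

variable {ι : Type*} [Fintype ι]

/-- A centered random variable with values in `{x_i} ∪ {0}`, the value `x_i` having weight `w_i`,
has moment generating function at most `1 + t² Var` as long as its range is small. -/
theorem sum_weight_exp_sub_one_le {w g : ι → ℝ} {t b : ℝ} (hw : ∀ i, 0 ≤ w i)
    (hw1 : ∑ i, w i ≤ 1) (hg : ∀ i, |g i| ≤ b) (hb : 0 ≤ b) (ht : |t| * b ≤ 1 / 2) :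
    Real.exp (-(t * ∑ i, w i * g i)) * (1 + ∑ i, w i * (Real.exp (t * g i) - 1)) - 1 ≤
      t ^ 2 * (∑ i, w i * g i ^ 2 - (∑ i, w i * g i) ^ 2) := by
  set h := ∑ i, w i * g i with hh
  set s := ∑ i, w i with hs
  have hhb : |h| ≤ b := by
    calc |h| ≤ ∑ i, |w i * g i| := Finset.abs_sum_le_sum_abs _ _
      _ ≤ ∑ i, w i * b := by
        refine Finset.sum_le_sum fun i _ => ?_
        rw [abs_mul, abs_of_nonneg (hw i)]
        exact mul_le_mul_of_nonneg_left (hg i) (hw i)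
      _ = s * b := by rw [← Finset.sum_mul]
      _ ≤ b := by nlinarith
  -- Centered values are at most `2b`, so `|t| b ≤ 1/2` puts the exponent in `[-1, 1]`, where `e^x ≤
  -- 1 + x + x²`.
  have key : ∀ x : ℝ, |x| ≤ 2 * b → Real.exp (t * x) ≤ 1 + t * x + t ^ 2 * x ^ 2 := by
    intro x hx
    have h1 : |t * x| ≤ 1 := by
      rw [abs_mul]; nlinarith [abs_nonneg t]
    have := (abs_le.1 (Real.abs_exp_sub_one_sub_id_le h1)).2
    nlinarith
  -- The missing mass `1 - s` sits at the value `0`.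
  have e1 : Real.exp (-(t * h)) * (1 + ∑ i, w i * (Real.exp (t * g i) - 1)) =
      (1 - s) * Real.exp (t * (0 - h)) + ∑ i, w i * Real.exp (t * (g i - h)) := by
    have : ∀ i, w i * Real.exp (t * (g i - h)) =
        Real.exp (-(t * h)) * (w i * Real.exp (t * g i)) := by
      intro i
      rw [mul_sub, sub_eq_add_neg, Real.exp_add]; ring
    simp_rw [this, ← Finset.mul_sum, mul_sub, Finset.sum_sub_distrib, mul_one, ← hs]
    rw [show t * (0 : ℝ) - t * h = -(t * h) by ring]
    ring
  have e2 : (1 - s) * Real.exp (t * (0 - h)) ≤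
      (1 - s) * (1 + t * (0 - h) + t ^ 2 * (0 - h) ^ 2) := by
    refine mul_le_mul_of_nonneg_left (key _ ?_) (by linarith)
    rw [zero_sub, abs_neg]; linarith
  have e3 : ∑ i, w i * Real.exp (t * (g i - h)) ≤
      ∑ i, w i * (1 + t * (g i - h) + t ^ 2 * (g i - h) ^ 2) := by
    refine Finset.sum_le_sum fun i _ => mul_le_mul_of_nonneg_left (key _ ?_) (hw i)
    calc |g i - h| ≤ |g i| + |h| := abs_sub _ _
      _ ≤ 2 * b := by linarith [hg i]
  have e4 : ∑ i, w i * (1 + t * (g i - h) + t ^ 2 * (g i - h) ^ 2) =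
      s * (1 - t * h + t ^ 2 * h ^ 2) + (t - 2 * t ^ 2 * h) * h +
        t ^ 2 * ∑ i, w i * g i ^ 2 := by
    rw [hs, Finset.sum_mul]
    rw [show (t - 2 * t ^ 2 * h) * h = ∑ i, (t - 2 * t ^ 2 * h) * (w i * g i) by
      rw [← Finset.mul_sum], Finset.mul_sum Finset.univ (fun i => w i * g i ^ 2), ← Finset.sum_add_distrib, ← Finset.sum_add_distrib]
    refine Finset.sum_congr rfl fun i _ => ?_
    ring
  rw [e1]
  calc _ ≤ (1 - s) * (1 + t * (0 - h) + t ^ 2 * (0 - h) ^ 2) +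
      (s * (1 - t * h + t ^ 2 * h ^ 2) + (t - 2 * t ^ 2 * h) * h +
        t ^ 2 * ∑ i, w i * g i ^ 2) - 1 := by linarith
    _ = _ := by ring

theorem trace_conjTranspose_mul_diagonal_mul (Q : Matrix ι ι ℂ) (a : ι → ℝ) :
    (∑ j, ∑ i, Complex.normSq (Q i j) * a i) = ∑ i, a i * ((Q * Qᴴ) i i).re := by
  rw [Finset.sum_comm]
  refine Finset.sum_congr rfl fun i _ => ?_
  rw [Matrix.mul_apply, Complex.re_sum, Finset.mul_sum]
  refine Finset.sum_congr rfl fun j _ => ?_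
  rw [conjTranspose_apply, RCLike.star_def, Complex.mul_conj, Complex.ofReal_re, mul_comm]

variable [DecidableEq ι]

/-- Expansion of `det (1 + diag(u) K)` along the principal minors of `K`. -/
theorem det_one_add_diagonal_mul {R : Type*} [CommRing R] (u : ι → R) (K : Matrix ι ι R) :
    (1 + diagonal u * K).det =
      ∑ T : Finset ι, (∏ i ∈ T, u i) *
        (K.submatrix (fun i : T => (i : ι)) (fun i : T => (i : ι))).det := by
  have h1 : (1 + diagonal u * K).det =
      (detRowAlternating : (ι → R) [⋀^ι]→ₗ[R] R)
        ((fun i => (diagonal u * K) i) + fun i => (1 : Matrix ι ι R) i) := by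
    rw [add_comm]; rfl
  rw [h1, AlternatingMap.map_add_univ]
  refine Finset.sum_congr rfl fun T _ => ?_
  -- By multilinearity in the rows, `T` records which rows come from `diag(u) K`; the identity rows
  -- outside `T` reduce the determinant to the principal minor.
  have h2 : (T.piecewise (fun i => (diagonal u * K) i) fun i => (1 : Matrix ι ι R) i) =
      fun i => (if i ∈ T then u i else 1) •
        (T.piecewise K.row (1 : Matrix ι ι R).row) i := by
    funext i j
    by_cases hi : i ∈ T
    · simp [Finset.piecewise, hi, diagonal_mul, Matrix.row]
    · simp [Finset.piecewise, hi, Matrix.row]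
  rw [h2, AlternatingMap.map_smul_univ, Finset.prod_ite_mem, Finset.univ_inter, smul_eq_mul]
  congr 1
  exact det_piecewise_one_eq_submatrix_det K T

/-- Multiply `λ ≤ e^{λ-1}` over the eigenvalues, which are nonnegative. -/
theorem det_re_le_exp_trace_sub_card {M : Matrix ι ι ℂ} (hM : M.PosSemidef) :
    M.det.re ≤ Real.exp (M.trace.re - Fintype.card ι) := by
  have h1 : M.det = ((∏ i, hM.1.eigenvalues i : ℝ) : ℂ) := by
    rw [hM.1.det_eq_prod_eigenvalues]; push_cast; rfl
  have h2 : M.trace = ((∑ i, hM.1.eigenvalues i : ℝ) : ℂ) := by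
    rw [hM.1.trace_eq_sum_eigenvalues]; push_cast; rfl
  rw [h1, h2, Complex.ofReal_re, Complex.ofReal_re]
  have h3 : (∑ i, hM.1.eigenvalues i) - (Fintype.card ι : ℝ) =
      ∑ i, (hM.1.eigenvalues i - 1) := by
    simp [Finset.sum_sub_distrib]
  rw [h3, Real.exp_sum]
  refine Finset.prod_le_prod (fun i _ => hM.eigenvalues_nonneg i) fun i _ => ?_
  have := Real.add_one_le_exp (hM.1.eigenvalues i - 1)
  linarith

theorem conjTranspose_mul_diagonal_mul_apply_self (Q : Matrix ι ι ℂ) (a : ι → ℝ) (j : ι) :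
    (Qᴴ * diagonal (fun i => (a i : ℂ)) * Q) j j =
      ((∑ i, Complex.normSq (Q i j) * a i : ℝ) : ℂ) := by
  rw [Matrix.mul_apply]
  push_cast
  refine Finset.sum_congr rfl fun i _ => ?_
  rw [mul_diagonal, conjTranspose_apply, Complex.normSq_eq_conj_mul_self]
  simp only [RCLike.star_def]
  ring

/-- The logarithm of the Laplace functional of the determinantal process with kernel `Q Qᴴ` is
bounded by its second-order expansion, `Q` being chosen so that `Qᴴ diag(g) Q` is diagonal. -/
theorem det_one_add_le_exp {K Q : Matrix ι ι ℂ} {g h : ι → ℝ} {t b : ℝ} (hK : K = Q * Qᴴ)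
    (hQ : (1 - Qᴴ * Q).PosSemidef)
    (hd : Qᴴ * diagonal (fun i => (g i : ℂ)) * Q = diagonal fun i => (h i : ℂ))
    (hg : ∀ i, |g i| ≤ b) (hb : 0 ≤ b) (ht : |t| * b ≤ 1 / 2) :
    (1 + diagonal (fun i => ((Real.exp (t * g i) - 1 : ℝ) : ℂ)) * K).det.re ≤
      Real.exp (t * ∑ i, g i * (K i i).re + t ^ 2 * (∑ i, g i ^ 2 * (K i i).re -
        ∑ i, ∑ j, g i * g j * Complex.normSq (K i j))) := by
  set E : Matrix ι ι ℂ := diagonal (fun i => ((Real.exp (t * g i) - 1 : ℝ) : ℂ)) with hE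
  set E' : Matrix ι ι ℂ := diagonal (fun i => ((Real.exp (t * g i) : ℝ) : ℂ)) with hE'
  have hEE : E = E' - 1 := by
    rw [hE, hE', ← diagonal_one, diagonal_sub]
    congr 1; funext i; push_cast; rfl
  set M : Matrix ι ι ℂ := 1 + Qᴴ * E * Q with hM
  -- Splitting `e^{tg} - 1` writes `M` as `(1 - Qᴴ Q) + Qᴴ e^{tg} Q`, a sum of positive semidefinite
  -- matrices.
  have hMpos : M.PosSemidef := by
    have : M = (1 - Qᴴ * Q) + Qᴴ * E' * Q := by
      rw [hM, hEE, mul_sub, sub_mul, mul_one]; abel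
    rw [this]
    refine hQ.add (PosSemidef.conjTranspose_mul_mul_same (PosSemidef.diagonal fun i => ?_) Q)
    simpa using (Complex.zero_le_real.2 (Real.exp_pos (t * g i)).le)
  have hdet : (1 + E * K).det = M.det := by
    rw [hK, ← mul_assoc, det_one_add_mul_comm, hM, mul_assoc]
  have hw : ∀ j, ∑ i, Complex.normSq (Q i j) * g i = h j := by
    intro j
    have := conjTranspose_mul_diagonal_mul_apply_self Q g j
    rw [hd, diagonal_apply_eq] at this
    exact_mod_cast this.symm
  have hw1 : ∀ j, ∑ i, Complex.normSq (Q i j) ≤ 1 := by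
    intro j
    have h1 := hQ.diag_nonneg (i := j)
    have h2 := conjTranspose_mul_diagonal_mul_apply_self Q (fun _ => 1) j
    simp only [Complex.ofReal_one, diagonal_one, mul_one] at h2
    rw [Matrix.sub_apply, one_apply_eq, h2] at h1
    have h3 : (0 : ℂ) ≤ ((1 - ∑ i, Complex.normSq (Q i j) : ℝ) : ℂ) := by
      push_cast at h1 ⊢; exact h1
    linarith [Complex.zero_le_real.1 h3]
  have hMjj : ∀ j, M j j =
      ((1 + ∑ i, Complex.normSq (Q i j) * (Real.exp (t * g i) - 1) : ℝ) : ℂ) := by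
    intro j
    rw [hM, Matrix.add_apply, one_apply_eq, hE,
      conjTranspose_mul_diagonal_mul_apply_self Q (fun i => Real.exp (t * g i) - 1) j]
    push_cast; rfl
  -- Conjugation by `d` centers the `j`-th variable at its mean `h j`; without it the trace bound
  -- would leave first-order terms in the wrong place.
  set d : Matrix ι ι ℂ := diagonal (fun j => ((Real.exp (-(t * h j) / 2) : ℝ) : ℂ)) with hdd
  have hdH : dᴴ = d := by
    rw [hdd, diagonal_conjTranspose]
    congr 1; funext j
    exact Complex.conj_ofReal _
  have hZ : (d * M * d).PosSemidef := by
    have := hMpos.conjTranspose_mul_mul_same d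
    rwa [hdH] at this
  have hZdet : (d * M * d).det = ((Real.exp (-(t * ∑ j, h j)) : ℝ) : ℂ) * M.det := by
    have : d.det * d.det = ((Real.exp (-(t * ∑ j, h j)) : ℝ) : ℂ) := by
      rw [hdd, det_diagonal, ← Finset.prod_mul_distrib]
      simp_rw [← Complex.ofReal_mul, ← Real.exp_add, add_halves]
      rw [← Complex.ofReal_prod, ← Real.exp_sum, Finset.sum_neg_distrib, ← Finset.mul_sum]
    rw [det_mul, det_mul, ← this]; ring
  have hZtr : (d * M * d).trace.re - Fintype.card ι =
      ∑ j, (Real.exp (-(t * h j)) *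
        (1 + ∑ i, Complex.normSq (Q i j) * (Real.exp (t * g i) - 1)) - 1) := by
    rw [Matrix.trace, Complex.re_sum, Finset.sum_sub_distrib]
    congr 1
    · refine Finset.sum_congr rfl fun j _ => ?_
      rw [diag_apply, hdd, mul_diagonal, diagonal_mul, hMjj, ← Complex.ofReal_mul,
        ← Complex.ofReal_mul, Complex.ofReal_re, mul_right_comm, ← Real.exp_add, add_halves]
    · simp
  have hZle := det_re_le_exp_trace_sub_card hZ
  rw [hZdet, Complex.re_ofReal_mul, hZtr] at hZle
  have hcol : ∀ j, Real.exp (-(t * h j)) *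
        (1 + ∑ i, Complex.normSq (Q i j) * (Real.exp (t * g i) - 1)) - 1 ≤
      t ^ 2 * (∑ i, Complex.normSq (Q i j) * g i ^ 2 - h j ^ 2) := by
    intro j
    have := sum_weight_exp_sub_one_le (fun i => Complex.normSq_nonneg (Q i j)) (hw1 j) hg hb ht
    rwa [hw j] at this
  have hsum1 : ∑ j, h j = ∑ i, g i * (K i i).re := by
    rw [hK, ← trace_conjTranspose_mul_diagonal_mul]
    exact Finset.sum_congr rfl fun j _ => (hw j).symm
  have hsum2 : ∑ j, ∑ i, Complex.normSq (Q i j) * g i ^ 2 = ∑ i, g i ^ 2 * (K i i).re := by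
    rw [hK, ← trace_conjTranspose_mul_diagonal_mul Q (fun i => g i ^ 2)]
  -- Here the vanishing of the off-diagonal entries is needed: `∑ h_j² = tr((Qᴴ G Q)²) = tr(G K G
  -- K)`.
  have hsum3 : ∑ j, h j ^ 2 = ∑ i, ∑ j, g i * g j * Complex.normSq (K i j) := by
    set G : Matrix ι ι ℂ := diagonal (fun i => (g i : ℂ)) with hG
    have h1 : (diagonal (fun i => (h i : ℂ)) * diagonal (fun i => (h i : ℂ))).trace =
        (G * K * (G * K)).trace := by
      rw [← hd, hK, mul_assoc, mul_assoc, trace_mul_comm]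
      simp only [mul_assoc]
    have hKH : Kᴴ = K := by rw [hK, conjTranspose_mul, conjTranspose_conjTranspose]
    have h2 : (G * K * (G * K)).trace =
        ((∑ i, ∑ j, g i * g j * Complex.normSq (K i j) : ℝ) : ℂ) := by
      rw [Matrix.trace]
      push_cast
      refine Finset.sum_congr rfl fun i _ => ?_
      rw [diag_apply, Matrix.mul_apply]
      refine Finset.sum_congr rfl fun j _ => ?_
      have h3 : K j i = star (K i j) := by rw [← conjTranspose_apply, hKH]
      rw [hG, diagonal_mul, diagonal_mul, h3, ← Complex.mul_conj, RCLike.star_def]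
      ring
    rw [h2, diagonal_mul_diagonal, trace_diagonal] at h1
    have h4 : ((∑ j, h j ^ 2 : ℝ) : ℂ) = ∑ j, (h j : ℂ) * (h j : ℂ) := by
      push_cast
      exact Finset.sum_congr rfl fun j _ => by ring
    rw [← h4] at h1
    exact_mod_cast h1
  have hle : ∑ j, (Real.exp (-(t * h j)) *
        (1 + ∑ i, Complex.normSq (Q i j) * (Real.exp (t * g i) - 1)) - 1) ≤
      t ^ 2 * (∑ i, g i ^ 2 * (K i i).re - ∑ i, ∑ j, g i * g j * Complex.normSq (K i j)) := by
    rw [← hsum2, ← hsum3, ← Finset.sum_sub_distrib, Finset.mul_sum]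
    exact Finset.sum_le_sum fun j _ => hcol j
  rw [hdet, ← hsum1, Real.exp_add]
  calc M.det.re = Real.exp (t * ∑ j, h j) * (Real.exp (-(t * ∑ j, h j)) * M.det.re) := by
        rw [← mul_assoc, ← Real.exp_add, add_neg_cancel, Real.exp_zero, one_mul]
    _ ≤ _ := mul_le_mul_of_nonneg_left (hZle.trans (Real.exp_le_exp.2 hle)) (Real.exp_pos _).le

theorem exists_unitary_diagonalization {A : Matrix ι ι ℂ} (hA : A.IsHermitian) :
    ∃ U : Matrix ι ι ℂ, Uᴴ * U = 1 ∧ U * Uᴴ = 1 ∧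
      A = U * diagonal (fun i => (hA.eigenvalues i : ℂ)) * Uᴴ :=
  ⟨hA.eigenvectorUnitary, Unitary.coe_star_mul_self hA.eigenvectorUnitary,
    Unitary.coe_mul_star_self hA.eigenvectorUnitary, hA.spectral_theorem⟩

/-- A Hermitian matrix with spectrum in `[0, 1]` factors as `Q Qᴴ` with `Qᴴ Q ≤ 1` and
`Qᴴ diag(g) Q` diagonal. -/
theorem exists_factorization {K : Matrix ι ι ℂ} (hK : K.IsHermitian)
    (h0 : ∀ i, 0 ≤ hK.eigenvalues i) (h1 : ∀ i, hK.eigenvalues i ≤ 1) (g : ι → ℝ) :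
    ∃ (Q : Matrix ι ι ℂ) (h : ι → ℝ), K = Q * Qᴴ ∧ (1 - Qᴴ * Q).PosSemidef ∧
      Qᴴ * diagonal (fun i => (g i : ℂ)) * Q = diagonal fun i => (h i : ℂ) := by
  obtain ⟨U, hUU, -, hKU'⟩ := exists_unitary_diagonalization hK
  set R : Matrix ι ι ℂ := diagonal fun i => ((Real.sqrt (hK.eigenvalues i) : ℝ) : ℂ) with hR
  have hRH : Rᴴ = R := by
    rw [hR, diagonal_conjTranspose]
    congr 1; funext j
    exact Complex.conj_ofReal _
  have hRR : R * R = diagonal fun i => (hK.eigenvalues i : ℂ) := by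
    rw [hR, diagonal_mul_diagonal]
    congr 1; funext i
    rw [← Complex.ofReal_mul, Real.mul_self_sqrt (h0 i)]
  have hKU : K = U * (R * R) * Uᴴ := by
    rw [hRR]
    exact hKU'
  set G : Matrix ι ι ℂ := diagonal fun i => (g i : ℂ) with hG
  have hGH : Gᴴ = G := by
    rw [hG, diagonal_conjTranspose]
    congr 1; funext j
    exact Complex.conj_ofReal _
  have hH : ((U * R)ᴴ * G * (U * R)).IsHermitian := by
    have : (G).IsHermitian := hGH
    exact isHermitian_conjTranspose_mul_mul (U * R) this
  obtain ⟨W, hWW, hWW', hHW⟩ := exists_unitary_diagonalization hH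
  obtain ⟨h, hh⟩ : ∃ h, h = hH.eigenvalues := ⟨_, rfl⟩
  rw [← hh] at hHW
  -- `U R` is already a factor of `K`; the unitary `W` diagonalizes the compression of `G` and
  -- leaves `Q Qᴴ` unchanged.
  refine ⟨U * R * W, h, ?_, ?_, ?_⟩
  · rw [conjTranspose_mul, conjTranspose_mul, hRH]
    calc K = U * (R * R) * Uᴴ := hKU
      _ = U * R * (W * Wᴴ) * (R * Uᴴ) := by rw [hWW', mul_one]; simp only [mul_assoc]
      _ = _ := by simp only [mul_assoc]
  · have e : 1 - (U * R * W)ᴴ * (U * R * W) = Wᴴ * (1 - R * R) * W := by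
      rw [conjTranspose_mul, conjTranspose_mul, hRH, mul_sub, sub_mul, mul_one, hWW]
      congr 1
      calc Wᴴ * (R * Uᴴ) * (U * R * W) = Wᴴ * (R * (Uᴴ * U) * R) * W := by
            simp only [mul_assoc]
        _ = _ := by rw [hUU, mul_one]
    rw [e]
    refine PosSemidef.conjTranspose_mul_mul_same ?_ W
    rw [hRR, ← diagonal_one, diagonal_sub]
    refine PosSemidef.diagonal fun i => ?_
    have : (0 : ℂ) ≤ ((1 - hK.eigenvalues i : ℝ) : ℂ) :=
      Complex.zero_le_real.2 (by linarith [h1 i])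
    simpa using this
  · calc (U * R * W)ᴴ * G * (U * R * W) = Wᴴ * ((U * R)ᴴ * G * (U * R)) * W := by
          rw [conjTranspose_mul]; simp only [mul_assoc]
      _ = (Wᴴ * W) * diagonal (fun i => (h i : ℂ)) * (Wᴴ * W) := by
          rw [hHW]; simp only [mul_assoc]
      _ = _ := by rw [hWW, one_mul, mul_one]

/-- The matrix is `1 - K/λ`, which kills an eigenvector of `λ`. -/
theorem det_one_add_diagonal_mul_eq_zero {K : Matrix ι ι ℂ} (hK : K.IsHermitian) {i : ι}
    (hi : hK.eigenvalues i ≠ 0) :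
    (1 + diagonal (fun _ => ((-(hK.eigenvalues i)⁻¹ : ℝ) : ℂ)) * K).det = 0 := by
  refine exists_mulVec_eq_zero_iff.1 ⟨⇑(hK.eigenvectorBasis i), ?_, ?_⟩
  · intro h0
    refine hK.eigenvectorBasis.orthonormal.ne_zero i ?_
    ext j
    exact congrFun h0 j
  · rw [add_mulVec, one_mulVec, ← mulVec_mulVec, hK.mulVec_eigenvectorBasis]
    funext j
    rw [Pi.add_apply, mulVec_diagonal]
    have : (hK.eigenvalues i : ℂ) ≠ 0 := by exact_mod_cast hi
    simp [this]

end MatrixAux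

end DPPCoreset

namespace DPPCoreset

open Matrix
open scoped ComplexOrder

/-! ### Laplace functional, moments and concentration of a determinantal process -/

section PointProcess

variable {Ω ι : Type*} [MeasurableSpace Ω] [Fintype ι] [DecidableEq ι]
  {P : Measure Ω} [IsProbabilityMeasure P] {S : Ω → Finset ι} {K : Matrix ι ι ℂ}

namespace IsDPP

omit [IsProbabilityMeasure P] in
theorem measurable_comp (hS : IsDPP P S K) (φ : Finset ι → ℝ) :
    Measurable fun ω => φ (S ω) := by
  let : MeasurableSpace (Finset ι) := ⊤
  have h : Measurable S := measurable_to_countable' hS.measurableSet_eq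
  exact measurable_from_top.comp h

theorem integrable_comp (hS : IsDPP P S K) (φ : Finset ι → ℝ) :
    Integrable (fun ω => φ (S ω)) P := by
  refine Integrable.of_bound (hS.measurable_comp φ).aestronglyMeasurable (∑ T, |φ T|)
    (Filter.Eventually.of_forall fun ω => ?_)
  exact Finset.single_le_sum (f := fun T => |φ T|) (fun T _ => abs_nonneg _) (Finset.mem_univ (S ω))

theorem memLp_two_comp (hS : IsDPP P S K) (φ : Finset ι → ℝ) :
    MemLp (fun ω => φ (S ω)) 2 P :=
  (memLp_two_iff_integrable_sq (hS.measurable_comp φ).aestronglyMeasurable).2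
    (hS.integrable_comp fun T => φ T ^ 2)

theorem integral_comp (hS : IsDPP P S K) (φ : Finset ι → ℝ) :
    ∫ ω, φ (S ω) ∂P = ∑ T, P.real {ω | S ω = T} * φ T := by
  have h : ∀ ω, φ (S ω) = ∑ T, {ω | S ω = T}.indicator (fun _ => φ T) ω := by
    intro ω
    simp [Set.indicator_apply]
  simp_rw [h]
  rw [integral_finsetSum _ fun T _ =>
    (integrable_const (φ T)).indicator (hS.measurableSet_eq T)]
  refine Finset.sum_congr rfl fun T _ => ?_
  rw [integral_indicator_const _ (hS.measurableSet_eq T), smul_eq_mul]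

omit [IsProbabilityMeasure P] in
theorem measurableSet_subset (hS : IsDPP P S K) (T : Finset ι) :
    MeasurableSet {ω | T ⊆ S ω} := by
  let : MeasurableSpace (Finset ι) := ⊤
  have h : Measurable S := measurable_to_countable' hS.measurableSet_eq
  exact h (t := {s | T ⊆ s}) trivial

omit [IsProbabilityMeasure P] in
theorem integral_ite_subset (hS : IsDPP P S K) (T : Finset ι) :
    ∫ ω, (if T ⊆ S ω then (1 : ℝ) else 0) ∂P = P.real {ω | T ⊆ S ω} := by
  rw [← integral_indicator_one (hS.measurableSet_subset T)]
  refine integral_congr_ae (Filter.Eventually.of_forall fun ω => ?_)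
  simp [Set.indicator_apply]

/-- The Laplace functional of a determinantal point process is a Fredholm determinant. -/
theorem integral_prod_one_add (hS : IsDPP P S K) (u : ι → ℝ) :
    ((∫ ω, ∏ i ∈ S ω, (1 + u i) ∂P : ℝ) : ℂ) =
      (1 + diagonal (fun i => (u i : ℂ)) * K).det := by
  have h : ∀ ω, ∏ i ∈ S ω, (1 + u i) =
      ∑ T : Finset ι, (∏ i ∈ T, u i) * (if T ⊆ S ω then (1 : ℝ) else 0) := by
    intro ω
    rw [Finset.prod_one_add]
    simp only [mul_ite, mul_one, mul_zero]
    rw [← Finset.sum_filter]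
    refine Finset.sum_congr ?_ fun _ _ => rfl
    ext T; simp
  simp_rw [h]
  rw [integral_finsetSum _ fun T _ =>
    (hS.integrable_comp fun s => if T ⊆ s then (1 : ℝ) else 0).const_mul _,
    det_one_add_diagonal_mul]
  push_cast
  refine Finset.sum_congr rfl fun T _ => ?_
  rw [integral_const_mul, hS.integral_ite_subset, ← hS.prob_subset]
  push_cast
  rfl

/-- With `q = 1 - 1/λ`, the Laplace functional gives `E q^{|S|} = det(1 - K/λ) = 0`, impossible for
`q > 0`. Both `λ < 0` and `λ > 1` would make `q` positive. -/
theorem one_sub_inv_eigenvalue_nonpos (hS : IsDPP P S K) (hK : K.IsHermitian) {i : ι}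
    (hi : hK.eigenvalues i ≠ 0) : 1 - (hK.eigenvalues i)⁻¹ ≤ 0 := by
  by_contra! hpos
  have h1 := hS.integral_prod_one_add fun _ => -(hK.eigenvalues i)⁻¹
  rw [det_one_add_diagonal_mul_eq_zero hK hi] at h1
  have h2 : ∫ ω, ∏ _i ∈ S ω, (1 + -(hK.eigenvalues i)⁻¹) ∂P = 0 := by exact_mod_cast h1
  set q := 1 + -(hK.eigenvalues i)⁻¹ with hq
  have hq0 : 0 < q := by rw [hq]; linarith
  simp only [Finset.prod_const] at h2
  have h3 := hS.integrable_comp fun s => q ^ s.card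
  have h4 := (integral_eq_zero_iff_of_nonneg (fun ω => (pow_pos hq0 _).le) h3).1 h2
  obtain ⟨ω, hω⟩ := h4.exists
  exact (pow_pos hq0 _).ne' hω

theorem eigenvalues_nonneg (hS : IsDPP P S K) (hK : K.IsHermitian) (i : ι) :
    0 ≤ hK.eigenvalues i := by
  by_contra! h
  have := hS.one_sub_inv_eigenvalue_nonpos hK h.ne
  have h2 := inv_neg''.2 h
  linarith

theorem eigenvalues_le_one (hS : IsDPP P S K) (hK : K.IsHermitian) (i : ι) :
    hK.eigenvalues i ≤ 1 := by
  by_contra! h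
  have := hS.one_sub_inv_eigenvalue_nonpos hK (by linarith)
  have h2 := inv_lt_one_of_one_lt₀ h
  linarith

omit [Fintype ι] [IsProbabilityMeasure P] in
theorem prob_mem (hS : IsDPP P S K) (i : ι) : P.real {ω | {i} ⊆ S ω} = (K i i).re := by
  have h := hS.prob_subset {i}
  rw [det_unique] at h
  rw [← Complex.ofReal_re (P.real _), h]
  rfl

omit [Fintype ι] [IsProbabilityMeasure P] in
theorem prob_pair (hS : IsDPP P S K) (hK : K.IsHermitian) {i j : ι} (hij : i ≠ j) :
    P.real {ω | {i, j} ⊆ S ω} = (K i i).re * (K j j).re - Complex.normSq (K i j) := by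
  have h := hS.prob_subset {i, j}
  let e : Fin 2 ≃ ({i, j} : Finset ι) :=
    { toFun := ![⟨i, by simp⟩, ⟨j, by simp⟩]
      invFun := fun x => if (x : ι) = i then 0 else 1
      left_inv := fun x => by fin_cases x <;> simp [hij.symm]
      right_inv := fun x => by
        obtain ⟨x, hx⟩ := x
        rcases Finset.mem_insert.1 hx with rfl | hx'
        · simp
        · obtain rfl := Finset.mem_singleton.1 hx'
          simp [hij.symm] }
  rw [← det_submatrix_equiv_self e, det_fin_two] at h
  have hd : ∀ k, K k k = ((K k k).re : ℂ) := fun k => (hK.coe_re_apply_self k).symm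
  have hji : K j i = (starRingEnd ℂ) (K i j) := (hK.apply j i).symm
  simp only [submatrix_apply, e, Equiv.coe_fn_mk, cons_val_zero, cons_val_one] at h
  rw [hji, Complex.mul_conj, hd i, hd j] at h
  exact_mod_cast h

theorem integral_sum (hS : IsDPP P S K) (g : ι → ℝ) :
    ∫ ω, ∑ i ∈ S ω, g i ∂P = ∑ i, g i * (K i i).re := by
  have h : ∀ ω, ∑ i ∈ S ω, g i = ∑ i, g i * (if {i} ⊆ S ω then (1 : ℝ) else 0) := by
    intro ω
    simp [Finset.sum_ite_mem]
  simp_rw [h]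
  rw [integral_finsetSum _ fun i _ =>
    (hS.integrable_comp fun s => if {i} ⊆ s then (1 : ℝ) else 0).const_mul _]
  refine Finset.sum_congr rfl fun i _ => ?_
  rw [integral_const_mul, hS.integral_ite_subset, hS.prob_mem]

theorem variance_sum (hS : IsDPP P S K) (hK : K.IsHermitian) (g : ι → ℝ) :
    variance (fun ω => ∑ i ∈ S ω, g i) P =
      ∑ i, g i ^ 2 * (K i i).re - ∑ i, ∑ j, g i * g j * Complex.normSq (K i j) := by
  rw [variance_eq_sub (hS.memLp_two_comp fun s => ∑ i ∈ s, g i), hS.integral_sum]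
  have h : ∀ ω, ((fun ω => ∑ i ∈ S ω, g i) ^ 2) ω =
      ∑ i, ∑ j, g i * g j * (if {i, j} ⊆ S ω then (1 : ℝ) else 0) := by
    intro ω
    have h0 : ∑ i ∈ S ω, g i = ∑ i, g i * (if i ∈ S ω then (1 : ℝ) else 0) := by
      simp [Finset.sum_ite_mem]
    rw [Pi.pow_apply, h0, sq, Finset.sum_mul_sum]
    refine Finset.sum_congr rfl fun i _ => Finset.sum_congr rfl fun j _ => ?_
    have hij : {i, j} ⊆ S ω ↔ i ∈ S ω ∧ j ∈ S ω := by
      rw [Finset.insert_subset_iff, Finset.singleton_subset_iff]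
    simp only [hij]
    by_cases hi : i ∈ S ω <;> by_cases hj : j ∈ S ω <;>
      simp only [hi, hj, if_true, if_false, and_true, and_false, mul_one, mul_zero, zero_mul]
  simp_rw [h]
  have hint : ∀ i j, Integrable
      (fun ω => g i * g j * (if {i, j} ⊆ S ω then (1 : ℝ) else 0)) P := fun i j =>
    hS.integrable_comp fun s => g i * g j * (if {i, j} ⊆ s then (1 : ℝ) else 0)
  rw [integral_finsetSum _ fun i _ => integrable_finsetSum _ fun j _ => hint i j]
  simp_rw [integral_finsetSum _ fun j _ => hint _ j, integral_const_mul, hS.integral_ite_subset]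
  -- For `i = j` the two-point formula gives `0`; the correction restores `P(i ∈ S)` and becomes the
  -- sum with `g i ^ 2`.
  have hp : ∀ i j, P.real {ω | {i, j} ⊆ S ω} = (K i i).re * (K j j).re -
      Complex.normSq (K i j) + if i = j then (K i i).re else 0 := by
    intro i j
    by_cases hij : i = j
    · subst hij
      have hd : Complex.normSq (K i i) = (K i i).re * (K i i).re := by
        rw [← hK.coe_re_apply_self i]; exact Complex.normSq_ofReal _
      rw [Finset.pair_eq_singleton, hS.prob_mem, hd]
      simp
    · rw [hS.prob_pair hK hij]
      simp [hij]
  simp_rw [hp, mul_add, mul_sub, Finset.sum_add_distrib, Finset.sum_sub_distrib, mul_ite, mul_zero,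
    Finset.sum_ite_eq, Finset.mem_univ, if_true]
  rw [sq, Finset.sum_mul_sum]
  have e1 : ∀ i j, g i * g j * ((K i i).re * (K j j).re) =
      g i * (K i i).re * (g j * (K j j).re) := fun i j => by ring
  have e2 : ∀ i, g i * g i * (K i i).re = g i ^ 2 * (K i i).re := fun i => by ring
  simp_rw [e1, e2]
  ring

/-- The moment generating function of a linear statistic of a determinantal point process with
Hermitian kernel is sub-Gaussian near `0`, with variance proxy of the order of the variance. -/
theorem mgf_sum_le (hS : IsDPP P S K) (hK : K.IsHermitian) {g : ι → ℝ} {t b : ℝ}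
    (hg : ∀ i, |g i| ≤ b) (hb : 0 ≤ b) (ht : |t| * b ≤ 1 / 2) :
    mgf (fun ω => ∑ i ∈ S ω, g i) P t ≤
      Real.exp (t * ∑ i, g i * (K i i).re +
        t ^ 2 * variance (fun ω => ∑ i ∈ S ω, g i) P) := by
  obtain ⟨Q, h, hKQ, hQ, hd⟩ := exists_factorization hK (hS.eigenvalues_nonneg hK)
    (hS.eigenvalues_le_one hK) g
  rw [hS.variance_sum hK]
  refine le_trans (le_of_eq ?_) (det_one_add_le_exp hKQ hQ hd hg hb ht)
  rw [← hS.integral_prod_one_add, Complex.ofReal_re, mgf]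
  refine integral_congr_ae (Filter.Eventually.of_forall fun ω => ?_)
  simp only [add_sub_cancel]
  rw [Finset.mul_sum, Real.exp_sum]

/-- Sub-Gaussian concentration of linear statistics of a determinantal point process. -/
theorem prob_abs_sub_ge_le (hS : IsDPP P S K) (hK : K.IsHermitian) {g : ι → ℝ} {a b V : ℝ}
    (hg : ∀ i, |g i| ≤ b) (hb : 0 ≤ b) (hV : 0 < V)
    (hvar : variance (fun ω => ∑ i ∈ S ω, g i) P ≤ V) (ha : 0 ≤ a) (hab : a * b ≤ V) :
    P.real {ω | a ≤ |∑ i ∈ S ω, g i - ∑ i, g i * (K i i).re|} ≤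
      2 * Real.exp (-(a ^ 2 / (4 * V))) := by
  set X : Ω → ℝ := fun ω => ∑ i ∈ S ω, g i with hX
  set μ := ∑ i, g i * (K i i).re with hμ
  -- The minimizer of `-t a + t² V`; the condition `a b ≤ V` is exactly `t b ≤ 1/2`.
  set t := a / (2 * V) with ht
  have ht0 : 0 ≤ t := by positivity
  have htb : t * b ≤ 1 / 2 := by
    rw [ht, div_mul_eq_mul_div, div_le_iff₀ (by positivity)]; linarith
  have hexp : ∀ s : ℝ, Integrable (fun ω => Real.exp (s * X ω)) P := fun s =>
    hS.integrable_comp fun T => Real.exp (s * ∑ i ∈ T, g i)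
  have htV : t ^ 2 * variance X P ≤ t ^ 2 * V := mul_le_mul_of_nonneg_left hvar (sq_nonneg t)
  have hfin : -(t * a) + t ^ 2 * V = -(a ^ 2 / (4 * V)) := by
    rw [ht]; field_simp; ring
  have h1 : P.real {ω | μ + a ≤ X ω} ≤ Real.exp (-(a ^ 2 / (4 * V))) := by
    refine (measure_ge_le_exp_mul_mgf (μ + a) ht0 (hexp t)).trans ?_
    have hm := hS.mgf_sum_le hK hg hb (t := t) (by rwa [abs_of_nonneg ht0])
    refine (mul_le_mul_of_nonneg_left hm (Real.exp_pos _).le).trans ?_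
    rw [← Real.exp_add, Real.exp_le_exp, ← hfin]
    linarith
  have h2 : P.real {ω | X ω ≤ μ - a} ≤ Real.exp (-(a ^ 2 / (4 * V))) := by
    refine (measure_le_le_exp_mul_mgf (μ - a) (neg_nonpos.2 ht0) (hexp (-t))).trans ?_
    have hm := hS.mgf_sum_le hK hg hb (t := -t) (by rwa [abs_neg, abs_of_nonneg ht0])
    refine (mul_le_mul_of_nonneg_left hm (Real.exp_pos _).le).trans ?_
    rw [← Real.exp_add, Real.exp_le_exp, ← hfin, neg_sq]
    linarith
  have hsub : {ω | a ≤ |X ω - μ|} ⊆ {ω | μ + a ≤ X ω} ∪ {ω | X ω ≤ μ - a} := by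
    intro ω hω
    rcases le_abs.1 (show a ≤ |X ω - μ| from hω) with h | h
    · exact Or.inl (by show μ + a ≤ X ω; linarith)
    · exact Or.inr (by show X ω ≤ μ - a; linarith)
  calc _ ≤ _ := measureReal_mono hsub
    _ ≤ _ := measureReal_union_le _ _
    _ ≤ _ := by linarith

end IsDPP

end PointProcess

end DPPCoreset

namespace DPPCoreset

/-! ### Nets and finite norming sets -/

section Nets

open Module Metric
open scoped ENNReal

variable {E : Type*} [NormedAddCommGroup E] [NormedSpace ℝ E] [FiniteDimensional ℝ E]

/-- Volumetric bound for the cardinality of a `δ`-separated subset of a ball of radius `R`. -/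
theorem card_le_of_separated {s : Finset E} {R δ : ℝ} (hR : 0 ≤ R) (hδ : 0 < δ)
    (hs : ∀ x ∈ s, ‖x‖ ≤ R) (h : ∀ x ∈ s, ∀ y ∈ s, x ≠ y → δ ≤ ‖x - y‖) :
    (s.card : ℝ) ≤ (1 + 2 * R / δ) ^ finrank ℝ E := by
  borelize E
  let μ : Measure E := Measure.addHaar
  have hr : 0 < R + δ / 2 := by positivity
  -- Disjoint balls of radius `δ/2` fit in a ball of radius `R + δ/2`; compare volumes.
  have hdisj : Set.Pairwise (s : Set E) (Function.onFun Disjoint fun x => ball (x : E) (δ / 2)) := by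
    intro x hx y hy hxy
    refine ball_disjoint_ball ?_
    rw [dist_eq_norm, add_halves]
    exact h x hx y hy hxy
  have hsub : ⋃ x ∈ s, ball (x : E) (δ / 2) ⊆ ball (0 : E) (R + δ / 2) := by
    refine Set.iUnion₂_subset fun x hx => ball_subset_ball' ?_
    rw [dist_zero_right]
    linarith [hs x hx]
  have h1 : (s.card : ℝ≥0∞) * ENNReal.ofReal ((δ / 2) ^ finrank ℝ E) * μ (ball 0 1) ≤
      ENNReal.ofReal ((R + δ / 2) ^ finrank ℝ E) * μ (ball 0 1) := by
    calc _ = μ (⋃ x ∈ s, ball (x : E) (δ / 2)) := by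
          rw [measure_biUnion_finset hdisj fun x _ => measurableSet_ball]
          simp only [μ.addHaar_ball_of_pos _ (half_pos hδ), Finset.sum_const, nsmul_eq_mul,
            mul_assoc]
      _ ≤ μ (ball (0 : E) (R + δ / 2)) := measure_mono hsub
      _ = _ := by rw [μ.addHaar_ball_of_pos _ hr]
  have h2 : (s.card : ℝ≥0∞) * ENNReal.ofReal ((δ / 2) ^ finrank ℝ E) ≤
      ENNReal.ofReal ((R + δ / 2) ^ finrank ℝ E) :=
    (ENNReal.mul_le_mul_iff_left (measure_ball_pos _ _ zero_lt_one).ne' measure_ball_lt_top.ne).1 h1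
  have h3 : (s.card : ℝ) * (δ / 2) ^ finrank ℝ E ≤ (R + δ / 2) ^ finrank ℝ E := by
    have := ENNReal.toReal_le_of_le_ofReal (by positivity) h2
    rwa [ENNReal.toReal_mul, ENNReal.toReal_natCast, ENNReal.toReal_ofReal (by positivity)] at this
  rw [← le_div_iff₀ (by positivity), ← div_pow] at h3
  have e : (R + δ / 2) / (δ / 2) = 1 + 2 * R / δ := by field_simp; ring
  rwa [e] at h3

/-- A subset of a ball of radius `R` has a `δ`-net of the volumetric cardinality. -/
theorem exists_net {A : Set E} {R δ : ℝ} (hR : 0 ≤ R) (hδ : 0 < δ) (hA : ∀ x ∈ A, ‖x‖ ≤ R) :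
    ∃ s : Finset E, (s : Set E) ⊆ A ∧ (s.card : ℝ) ≤ (1 + 2 * R / δ) ^ finrank ℝ E ∧
      ∀ x ∈ A, ∃ y ∈ s, ‖x - y‖ ≤ δ := by
  classical
  -- A separated set of largest cardinality is a net, since a point far from it could be added.
  let good : Set ℕ := {k | ∃ s : Finset E, (s : Set E) ⊆ A ∧
    (∀ x ∈ s, ∀ y ∈ s, x ≠ y → δ ≤ ‖x - y‖) ∧ s.card = k}
  have hcard : ∀ s : Finset E, (s : Set E) ⊆ A → (∀ x ∈ s, ∀ y ∈ s, x ≠ y → δ ≤ ‖x - y‖) →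
      (s.card : ℝ) ≤ (1 + 2 * R / δ) ^ finrank ℝ E := fun s hs hsep =>
    card_le_of_separated hR hδ (fun x hx => hA x (hs hx)) hsep
  have hbdd : BddAbove good := by
    refine ⟨⌊(1 + 2 * R / δ) ^ finrank ℝ E⌋₊, ?_⟩
    rintro _ ⟨s, hs, hsep, rfl⟩
    exact Nat.le_floor (hcard s hs hsep)
  obtain ⟨s, hs, hsep, hk⟩ := Nat.sSup_mem (s := good) ⟨0, ∅, by simp⟩ hbdd
  refine ⟨s, hs, hcard s hs hsep, fun x hx => ?_⟩
  by_contra! hfar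
  have hxs : x ∉ s := fun h => by
    have := hfar x h
    rw [sub_self, norm_zero] at this
    linarith
  have hins : (insert x s).card ∈ good := by
    refine ⟨insert x s, ?_, ?_, rfl⟩
    · rw [Finset.coe_insert]
      exact Set.insert_subset hx hs
    · intro y hy z hz hyz
      rcases Finset.mem_insert.1 hy with rfl | hy' <;> rcases Finset.mem_insert.1 hz with rfl | hz'
      · exact absurd rfl hyz
      · exact (hfar z hz').le
      · rw [norm_sub_rev]; exact (hfar y hy').le
      · exact hsep y hy' z hz' hyz
  have := le_csSup hbdd hins
  rw [Finset.card_insert_of_notMem hxs, ← hk] at this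
  omega

/-- A finite subset of the unit ball which controls the linear functionals on it. -/
theorem exists_norming_finset (E : Type*) [NormedAddCommGroup E] [NormedSpace ℝ E]
    [FiniteDimensional ℝ E] :
    ∃ s : Finset E, (s.card : ℝ) ≤ 5 ^ finrank ℝ E ∧ (∀ y ∈ s, ‖y‖ ≤ 1) ∧
      ∀ (l : E →ₗ[ℝ] ℝ) (a : ℝ), (∀ y ∈ s, |l y| < a / 2) → ∀ x, ‖x‖ ≤ 1 → |l x| < a := by
  obtain ⟨s, hs, hcard, hnet⟩ := exists_net (A := closedBall (0 : E) 1) (R := 1) (δ := 1 / 2)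
    zero_le_one (by norm_num) fun x hx => mem_closedBall_zero_iff.1 hx
  refine ⟨s, by norm_num at hcard; exact hcard, fun y hy => mem_closedBall_zero_iff.1 (hs hy),
    fun l a hl x hx => ?_⟩
  have : ProperSpace E := FiniteDimensional.proper ℝ E
  have hc : Continuous fun x => |l x| := (LinearMap.continuous_of_finiteDimensional l).abs
  obtain ⟨x₀, hx₀, hmax⟩ := (isCompact_closedBall (0 : E) 1).exists_isMaxOn
    ⟨0, mem_closedBall_self zero_le_one⟩ hc.continuousOn
  obtain ⟨y, hy, hxy⟩ := hnet x₀ hx₀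
  -- `2(x₀ - y)` lies in the unit ball again, so `|l x₀ - l y| ≤ |l x₀|/2` and hence `|l x₀| ≤ 2 |l
  -- y|`. Taking an attained maximum keeps the inequality strict.
  have h1 : |l ((2 : ℝ) • (x₀ - y))| ≤ |l x₀| := by
    refine hmax (mem_closedBall_zero_iff.2 ?_)
    rw [norm_smul, Real.norm_ofNat]
    linarith
  have h2 : |l x| ≤ |l x₀| := hmax (mem_closedBall_zero_iff.2 hx)
  rw [map_smul, smul_eq_mul, abs_mul, map_sub, abs_two] at h1
  have h3 := abs_sub_abs_le_abs_sub (l x₀) (l y)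
  linarith [hl y hy]

/-- Pulling back the norm of `W` along `φ` allows a unit ball adapted to the problem. -/
theorem exists_norming_finset_of_injective {E W : Type*} [AddCommGroup E] [Module ℝ E]
    [FiniteDimensional ℝ E] [NormedAddCommGroup W] [NormedSpace ℝ W] (φ : E →ₗ[ℝ] W)
    (hφ : Function.Injective φ) :
    ∃ s : Finset E, (s.card : ℝ) ≤ 5 ^ finrank ℝ E ∧ (∀ y ∈ s, ‖φ y‖ ≤ 1) ∧
      ∀ (l : E →ₗ[ℝ] ℝ) (a : ℝ), (∀ y ∈ s, |l y| < a / 2) → ∀ x, ‖φ x‖ ≤ 1 → |l x| < a := by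
  let := NormedAddCommGroup.induced E W φ hφ
  let := NormedSpace.induced ℝ E W φ
  exact exists_norming_finset E

end Nets

/-! ### From one query to all queries -/

section Coreset

variable {Ω : Type*} [MeasurableSpace Ω] {P : Measure Ω} {n : ℕ} {S : Ω → Finset (Fin n)}
  {K : Matrix (Fin n) (Fin n) ℂ} {F : Set (Fin n → ℝ)} {ρ c V : ℝ}

/-- The normalized estimation error `n⁻¹ (L_s(f) - L(f))`, as a linear functional of `f`. -/
noncomputable def estError (K : Matrix (Fin n) (Fin n) ℂ) (s : Finset (Fin n)) :
    (Fin n → ℝ) →ₗ[ℝ] ℝ where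
  toFun f := (n : ℝ)⁻¹ * (estLoss K s f - loss f)
  map_add' f g := by
    simp only [estLoss, loss, Pi.add_apply, add_div, Finset.sum_add_distrib]
    ring
  map_smul' r f := by
    simp only [estLoss, loss, Pi.smul_apply, smul_eq_mul, mul_div_assoc, ← Finset.mul_sum,
      RingHom.id_apply]
    ring

theorem estError_apply (K : Matrix (Fin n) (Fin n) ℂ) (s : Finset (Fin n)) (f : Fin n → ℝ) :
    estError K s f = (n : ℝ)⁻¹ * (estLoss K s f - loss f) := rfl

theorem expectedSize_nonneg : 0 ≤ expectedSize P S :=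
  integral_nonneg fun _ => Nat.cast_nonneg _

theorem Setting.natCast_pos (h : Setting P S K F ρ c V) (hc : 0 < c) {f : Fin n → ℝ}
    (hf : f ∈ F) : 0 < (n : ℝ) := by
  rcases Nat.eq_zero_or_pos n with h0 | h0
  · have := h.loss_ge f hf
    have hn : (n : ℝ) = 0 := by exact_mod_cast h0
    rw [hn, inv_zero, zero_mul] at this
    linarith
  · exact_mod_cast h0

/-- A relative error of at least `ε` forces a normalized error of at least `c ε`. -/
theorem Setting.le_abs_estError (h : Setting P S K F ρ c V) (hc : 0 < c) {f : Fin n → ℝ}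
    (hf : f ∈ F) {ε : ℝ} (hε : 0 ≤ ε) {s : Finset (Fin n)}
    (hbad : ε ≤ |estLoss K s f / loss f - 1|) : c * ε ≤ |estError K s f| := by
  have hl := h.loss_ge f hf
  have hn := h.natCast_pos hc hf
  have hl0 : loss f ≠ 0 := by
    intro h0
    rw [h0, abs_zero, mul_zero] at hl
    linarith
  have e : estError K s f = (n : ℝ)⁻¹ * loss f * (estLoss K s f / loss f - 1) := by
    rw [estError_apply]
    field_simp
  rw [e, abs_mul, abs_mul, abs_of_pos (inv_pos.2 hn)]
  exact mul_le_mul hl hbad hε (hc.le.trans hl)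

theorem Setting.diag_pos (h : Setting P S K F ρ c V) (hn : 0 < (n : ℝ)) (hρ : 0 < ρ)
    (hm : 0 < expectedSize P S) (i : Fin n) : 0 < (K i i).re :=
  lt_of_lt_of_le (by positivity) (h.diag_ge i)

/-- Since `n K_ii ≥ ρ m`, this supplies the range bound `b` for the concentration inequality. -/
theorem Setting.abs_div_diag_le (h : Setting P S K F ρ c V) (hn : 0 < (n : ℝ)) (hρ : 0 < ρ)
    (hm : 0 < expectedSize P S) (g : Fin n → ℝ) (i : Fin n) :
    |(n : ℝ)⁻¹ * (g i / (K i i).re)| ≤ ‖g‖ / (ρ * expectedSize P S) := by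
  have hK := h.diag_pos hn hρ hm i
  rw [abs_mul, abs_div, abs_of_pos hK, abs_of_pos (inv_pos.2 hn), ← Real.norm_eq_abs]
  have h1 := h.diag_ge i
  rw [div_le_iff₀ hn] at h1
  rw [inv_mul_eq_div, div_div]
  refine div_le_div₀ (norm_nonneg g) (norm_le_pi_norm g i) (by positivity) h1

theorem inv_mul_estLoss (s : Finset (Fin n)) (g : Fin n → ℝ) :
    (n : ℝ)⁻¹ * estLoss K s g = ∑ i ∈ s, (n : ℝ)⁻¹ * (g i / (K i i).re) := by
  rw [estLoss, Finset.mul_sum]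

/-- Concentration of the estimated loss of a single query. -/
theorem Setting.prob_estError_ge_le [IsProbabilityMeasure P] (h : Setting P S K F ρ c V)
    (hn : 0 < (n : ℝ)) (hρ : 0 < ρ) (hm : 0 < expectedSize P S) (hV : 0 < V) {g : Fin n → ℝ}
    (hvar : variance (fun ω => (n : ℝ)⁻¹ * estLoss K (S ω) g) P ≤ V) {a : ℝ} (ha : 0 ≤ a)
    (hag : a * ‖g‖ ≤ V * (ρ * expectedSize P S)) :
    P.real {ω | a ≤ |estError K (S ω) g|} ≤ 2 * Real.exp (-(a ^ 2 / (4 * V))) := by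
  simp_rw [inv_mul_estLoss] at hvar
  have key := h.isDPP.prob_abs_sub_ge_le h.isHermitian (h.abs_div_diag_le hn hρ hm g)
    (by positivity) hV hvar ha (by rw [mul_div_assoc', div_le_iff₀ (by positivity)]; exact hag)
  have hmean : ∑ i, (n : ℝ)⁻¹ * (g i / (K i i).re) * (K i i).re = (n : ℝ)⁻¹ * loss g := by
    rw [loss, Finset.mul_sum]
    refine Finset.sum_congr rfl fun i _ => ?_
    rw [mul_assoc, div_mul_cancel₀ _ (h.diag_pos hn hρ hm i).ne']
  rw [hmean] at key
  simp_rw [← inv_mul_estLoss, ← mul_sub] at key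
  exact key

/-- The centered estimated loss, as a vector of the `L²` space of the law of the process. -/
noncomputable def centeredEst (P : Measure Ω) (S : Ω → Finset (Fin n))
    (K : Matrix (Fin n) (Fin n) ℂ) :
    (Fin n → ℝ) →ₗ[ℝ] EuclideanSpace ℝ (Finset (Fin n)) where
  toFun f := WithLp.toLp 2 fun T => Real.sqrt (P.real {ω | S ω = T}) *
    ((n : ℝ)⁻¹ * estLoss K T f - ∑ T', P.real {ω | S ω = T'} * ((n : ℝ)⁻¹ * estLoss K T' f))
  map_add' f g := by
    ext T
    simp only [estLoss, Pi.add_apply, add_div, Finset.sum_add_distrib, mul_add, PiLp.add_apply]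
    ring
  map_smul' r f := by
    ext T
    have e : ∀ T, estLoss K T (r • f) = r * estLoss K T f := by
      intro T
      simp only [estLoss, Pi.smul_apply, smul_eq_mul, mul_div_assoc, ← Finset.mul_sum]
    have e2 : ∀ T', P.real {ω | S ω = T'} * ((n : ℝ)⁻¹ * (r * estLoss K T' f)) =
        r * (P.real {ω | S ω = T'} * ((n : ℝ)⁻¹ * estLoss K T' f)) := fun T' => by ring
    simp only [e, e2, ← Finset.mul_sum, PiLp.smul_apply, smul_eq_mul, RingHom.id_apply]
    ring

/-- Exhibits the standard deviation as a seminorm of the query, so that `Var ≤ V` can be part of a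
unit-ball condition. -/
theorem IsDPP.norm_centeredEst_sq [IsProbabilityMeasure P] (hS : IsDPP P S K) (f : Fin n → ℝ) :
    ‖centeredEst P S K f‖ ^ 2 = variance (fun ω => (n : ℝ)⁻¹ * estLoss K (S ω) f) P := by
  rw [variance_eq_integral (hS.measurable_comp fun T => (n : ℝ)⁻¹ * estLoss K T f).aemeasurable,
    hS.integral_comp fun T => (n : ℝ)⁻¹ * estLoss K T f]
  have := hS.integral_comp fun T => ((n : ℝ)⁻¹ * estLoss K T f -
    ∑ T', P.real {ω | S ω = T'} * ((n : ℝ)⁻¹ * estLoss K T' f)) ^ 2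
  rw [this, EuclideanSpace.norm_sq_eq]
  refine Finset.sum_congr rfl fun T _ => ?_
  simp only [centeredEst, LinearMap.coe_mk, AddHom.coe_mk]
  rw [Real.norm_eq_abs, sq_abs, mul_pow, Real.sq_sqrt measureReal_nonneg]

/-- The parameters are nondegenerate as soon as a positive accuracy is allowed. -/
theorem Setting.pos_of_accuracy [IsProbabilityMeasure P] (h : Setting P S K F ρ c V) (hc : 0 < c)
    {ε : ℝ} (hε : 0 < ε) {f : Fin n → ℝ} (hf : f ∈ F)
    (hεf : ε ≤ 4 * 1 * ρ * expectedSize P S * V / (3 * c * ‖f‖)) :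
    0 < expectedSize P S ∧ 0 < V ∧ ‖f‖ ≤ 4 * ρ * expectedSize P S * V / (3 * c * ε) := by
  have hV0 : 0 ≤ V := (variance_nonneg _ _).trans (h.variance_le f hf)
  have hm0 : 0 ≤ expectedSize P S := expectedSize_nonneg
  have hf0 : 0 < ‖f‖ := by
    -- For `‖f‖ = 0` the quotient is `0` by the convention `x / 0 = 0`, against `ε > 0`.
    refine lt_of_le_of_ne (norm_nonneg f) fun h0 => ?_
    rw [← h0, mul_zero, div_zero] at hεf
    linarith
  refine ⟨lt_of_le_of_ne hm0 fun h0 => ?_, lt_of_le_of_ne hV0 fun h0 => ?_, ?_⟩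
  · rw [← h0, mul_zero, zero_mul, zero_div] at hεf
    linarith
  · rw [← h0, mul_zero, zero_div] at hεf
    linarith
  · rw [le_div_iff₀ (by positivity)] at hεf ⊢
    linarith

/-- The net points lie in `span F` but perhaps not in `F`, so the bounds on their variance and sup
norm must come from the choice of norm. -/
theorem Setting.prob_badEvent_le_of_finrank [IsProbabilityMeasure P] (h : Setting P S K F ρ c V)
    (hρ : 0 < ρ) (hc : 0 < c) {ε : ℝ} (hε : 0 ≤ ε)
    (hεF : ∀ f ∈ F, ε ≤ 4 * 1 * ρ * expectedSize P S * V / (3 * c * ‖f‖)) :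
    P.real (badEvent S K F ε) ≤
      2 * Real.exp (6 * Module.finrank ℝ (Submodule.span ℝ F) - c ^ 2 * ε ^ 2 / (16 * 1 * V)) := by
  set D := Module.finrank ℝ (Submodule.span ℝ F) with hD
  rcases hε.eq_or_lt with rfl | hε
  · have h1 : 1 ≤ Real.exp (6 * D - c ^ 2 * 0 ^ 2 / (16 * 1 * V)) := by
      rw [Real.one_le_exp_iff]
      simp
    linarith [measureReal_le_one (μ := P) (s := badEvent S K F 0)]
  rcases F.eq_empty_or_nonempty with rfl | ⟨f₀, hf₀⟩
  · have : badEvent S K ∅ ε = ∅ := by simp [badEvent]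
    rw [this, measureReal_empty]
    positivity
  obtain ⟨hm, hV, -⟩ := h.pos_of_accuracy hc hε hf₀ (hεF f₀ hf₀)
  have hn := h.natCast_pos hc hf₀
  set M := 4 * ρ * expectedSize P S * V / (3 * c * ε) with hM
  have hMpos : 0 < M := by positivity
  have hFM : ∀ f ∈ F, ‖f‖ ≤ M := fun f hf => (h.pos_of_accuracy hc hε hf (hεF f hf)).2.2
  have hsV : 0 < Real.sqrt V := Real.sqrt_pos.2 hV
  -- The product carries the max norm, so `‖φ g‖ ≤ 1` says `‖g‖ ≤ M` and `Var ≤ V`. The first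
  -- component alone makes `φ` injective.
  let φ : (Fin n → ℝ) →ₗ[ℝ] (Fin n → ℝ) × EuclideanSpace ℝ (Finset (Fin n)) :=
    (M⁻¹ • LinearMap.id).prod ((Real.sqrt V)⁻¹ • centeredEst P S K)
  have hφ1 : ∀ g, ‖φ g‖ ≤ 1 ↔
      ‖g‖ ≤ M ∧ variance (fun ω => (n : ℝ)⁻¹ * estLoss K (S ω) g) P ≤ V := by
    intro g
    have e : φ g = (M⁻¹ • g, (Real.sqrt V)⁻¹ • centeredEst P S K g) := rfl
    rw [e, Prod.norm_mk, max_le_iff, norm_smul, norm_smul, Real.norm_of_nonneg (by positivity),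
      Real.norm_of_nonneg (by positivity), inv_mul_le_iff₀ hMpos, inv_mul_le_iff₀ hsV, mul_one,
      mul_one, ← h.isDPP.norm_centeredEst_sq, Real.le_sqrt (norm_nonneg _) hV.le]
  have hinj : Function.Injective (φ ∘ₗ (Submodule.span ℝ F).subtype) := by
    intro x y hxy
    have h1 : M⁻¹ • (x : Fin n → ℝ) = M⁻¹ • (y : Fin n → ℝ) := congrArg Prod.fst hxy
    exact Subtype.ext (smul_right_injective _ (inv_ne_zero hMpos.ne') h1)
  obtain ⟨s, hcard, hs, hnorming⟩ := exists_norming_finset_of_injective _ hinj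
  have hsub : badEvent S K F ε ⊆
      ⋃ y ∈ s, {ω | c * ε / 2 ≤ |estError K (S ω) (y : Fin n → ℝ)|} := by
    rintro ω ⟨f, hf, hbad⟩
    by_contra hω
    simp only [Set.mem_iUnion, Set.mem_ofPred_eq, not_exists, not_le] at hω
    have h1 := hnorming ((estError K (S ω)) ∘ₗ (Submodule.span ℝ F).subtype) (c * ε)
      (fun y hy => hω y hy) ⟨f, Submodule.subset_span hf⟩
      ((hφ1 f).2 ⟨hFM f hf, h.variance_le f hf⟩)
    exact absurd (h.le_abs_estError hc hf hε.le hbad) (not_le.2 h1)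
  have hpt : ∀ y ∈ s, P.real {ω | c * ε / 2 ≤ |estError K (S ω) (y : Fin n → ℝ)|} ≤
      2 * Real.exp (-((c * ε / 2) ^ 2 / (4 * V))) := by
    intro y hy
    obtain ⟨hy1, hy2⟩ := (hφ1 y).1 (hs y hy)
    refine h.prob_estError_ge_le hn hρ hm hV hy2 (by positivity) ?_
    calc c * ε / 2 * ‖(y : Fin n → ℝ)‖ ≤ c * ε / 2 * M :=
          mul_le_mul_of_nonneg_left hy1 (by positivity)
      -- The net halves the threshold to `cε/2`, so the range allowed for `ε` leaves a spare factor
      -- `2/3`.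
      _ = 2 / 3 * (V * (ρ * expectedSize P S)) := by rw [hM]; field_simp; ring
      _ ≤ _ := by
        have : 0 ≤ V * (ρ * expectedSize P S) := by positivity
        linarith
  have h5 : (5 : ℝ) ^ D ≤ Real.exp (6 * D) := by
    rw [mul_comm, Real.exp_nat_mul]
    refine pow_le_pow_left₀ (by norm_num) ?_ _
    linarith [Real.add_one_le_exp (6 : ℝ)]
  calc P.real (badEvent S K F ε) ≤ _ := measureReal_mono hsub (measure_ne_top _ _)
    _ ≤ ∑ y ∈ s, P.real {ω | c * ε / 2 ≤ |estError K (S ω) (y : Fin n → ℝ)|} :=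
      measureReal_biUnion_finset_le _ _
    _ ≤ ∑ _y ∈ s, 2 * Real.exp (-((c * ε / 2) ^ 2 / (4 * V))) := Finset.sum_le_sum hpt
    _ = s.card * (2 * Real.exp (-((c * ε / 2) ^ 2 / (4 * V)))) := by
      rw [Finset.sum_const, nsmul_eq_mul]
    _ ≤ Real.exp (6 * D) * (2 * Real.exp (-((c * ε / 2) ^ 2 / (4 * V)))) :=
      mul_le_mul_of_nonneg_right (hcard.trans h5) (by positivity)
    _ = _ := by
      rw [sub_eq_add_neg, Real.exp_add]
      have : (c * ε / 2) ^ 2 / (4 * V) = c ^ 2 * ε ^ 2 / (16 * 1 * V) := by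
        field_simp; ring
      rw [this]; ring

/-- On the event `|S| ≤ B m` the normalized error is Lipschitz in the query. -/
theorem Setting.abs_estError_le (h : Setting P S K F ρ c V) (hn : 0 < (n : ℝ)) (hρ : 0 < ρ)
    (hm : 0 < expectedSize P S) {B : ℝ} {s : Finset (Fin n)}
    (hs : (s.card : ℝ) ≤ B * expectedSize P S) (g : Fin n → ℝ) :
    |estError K s g| ≤ (B / ρ + 1) * ‖g‖ := by
  have h1 : |(n : ℝ)⁻¹ * estLoss K s g| ≤ B / ρ * ‖g‖ := by
    rw [inv_mul_estLoss]
    calc _ ≤ ∑ i ∈ s, |(n : ℝ)⁻¹ * (g i / (K i i).re)| := Finset.abs_sum_le_sum_abs _ _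
      _ ≤ ∑ _i ∈ s, ‖g‖ / (ρ * expectedSize P S) :=
        Finset.sum_le_sum fun i _ => h.abs_div_diag_le hn hρ hm g i
      _ = s.card * (‖g‖ / (ρ * expectedSize P S)) := by rw [Finset.sum_const, nsmul_eq_mul]
      _ ≤ B * expectedSize P S * (‖g‖ / (ρ * expectedSize P S)) :=
        mul_le_mul_of_nonneg_right hs (by positivity)
      _ = _ := by field_simp
  have h2 : |(n : ℝ)⁻¹ * loss g| ≤ ‖g‖ := by
    rw [abs_mul, abs_of_pos (inv_pos.2 hn), inv_mul_le_iff₀ hn, loss]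
    calc |∑ i, g i| ≤ ∑ i, |g i| := Finset.abs_sum_le_sum_abs _ _
      _ ≤ ∑ _i : Fin n, ‖g‖ := Finset.sum_le_sum fun i _ => norm_le_pi_norm g i
      _ = n * ‖g‖ := by rw [Finset.sum_const, nsmul_eq_mul, Finset.card_univ, Fintype.card_fin]
  rw [estError_apply, mul_sub]
  calc _ ≤ |(n : ℝ)⁻¹ * estLoss K s g| + |(n : ℝ)⁻¹ * loss g| := abs_sub _ _
    _ ≤ _ := by linarith

/-- The net is chosen inside `Θ`, so its queries belong to the family and inherit the variance
bound. -/
theorem prob_badEvent_le_of_lipschitz [IsProbabilityMeasure P] {D : ℕ}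
    {Θ : Set (EuclideanSpace ℝ (Fin D))} {f : Θ → Fin n → ℝ} {B ℓ R : ℝ}
    (h : Setting P S K (Set.range f) ρ c V) (hR : 0 < R) (hΘ : ∀ θ ∈ Θ, ‖θ‖ ≤ R) (hB : 0 < B)
    (hρ : 0 < ρ) (hℓ : 0 < ℓ) (hc : 0 < c)
    (hf : ∀ θ θ' : Θ, ‖f θ - f θ'‖ ≤
      ℓ * ‖(θ : EuclideanSpace ℝ (Fin D)) - (θ' : EuclideanSpace ℝ (Fin D))‖)
    (hS : ∀ᵐ ω ∂P, ((S ω).card : ℝ) ≤ B * expectedSize P S) {ε : ℝ} (hε : 0 ≤ ε)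
    (hεF : ∀ g ∈ Set.range f, ε ≤ 4 * 1 * ρ * expectedSize P S * V / (3 * c * ‖g‖)) :
    P.real (badEvent S K (Set.range f) ε) ≤
      2 * Real.exp (Real.log (1 + 2 * R / (c / (2 * ℓ * (B / ρ + 1)))) * D -
        D * Real.log (min ε 1) - c ^ 2 * ε ^ 2 / (16 * 1 * V)) := by
  -- Chosen so that moving `θ` by `κ min(ε, 1)` changes the error by at most `c ε / 2`.
  set κ := c / (2 * ℓ * (B / ρ + 1)) with hκ
  have hκ0 : 0 < κ := by positivity
  have hRκ : 0 < 2 * R / κ := by positivity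
  rcases hε.eq_or_lt with rfl | hε
  · have h1 : 1 ≤ Real.exp (Real.log (1 + 2 * R / κ) * D -
        D * Real.log (min 0 1) - c ^ 2 * 0 ^ 2 / (16 * 1 * V)) := by
      -- At `ε = 0` the convention `log 0 = 0` leaves a nonnegative exponent.
      rw [Real.one_le_exp_iff, min_eq_left zero_le_one, Real.log_zero]
      have : 0 ≤ Real.log (1 + 2 * R / κ) := Real.log_nonneg (by linarith)
      have : 0 ≤ Real.log (1 + 2 * R / κ) * D := by positivity
      simpa using this
    linarith [measureReal_le_one (μ := P) (s := badEvent S K (Set.range f) 0)]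
  rcases (Set.range f).eq_empty_or_nonempty with hemp | ⟨f₀, hf₀⟩
  · have : badEvent S K (Set.range f) ε = ∅ := by simp [badEvent, hemp]
    rw [this, measureReal_empty]
    positivity
  obtain ⟨hm, hV, -⟩ := h.pos_of_accuracy hc hε hf₀ (hεF f₀ hf₀)
  have hn := h.natCast_pos hc hf₀
  set q := min ε 1 with hq
  have hq0 : 0 < q := lt_min hε one_pos
  obtain ⟨s, hsΘ, hcard, hnet⟩ := exists_net hR.le (mul_pos hκ0 hq0) hΘ
  rw [finrank_euclideanSpace_fin] at hcard
  have hsub : ∀ᵐ ω ∂P, ω ∈ badEvent S K (Set.range f) ε → ω ∈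
      ⋃ y ∈ s.attach, {ω | c * ε / 2 ≤ |estError K (S ω) (f ⟨y, hsΘ y.2⟩)|} := by
    filter_upwards [hS] with ω hω
    rintro ⟨_, ⟨θ, rfl⟩, hbad⟩
    obtain ⟨y, hy, hθy⟩ := hnet θ θ.2
    simp only [Set.mem_iUnion, Set.mem_ofPred_eq]
    refine ⟨⟨y, hy⟩, Finset.mem_attach _ _, ?_⟩
    have h1 := h.le_abs_estError hc ⟨θ, rfl⟩ hε.le hbad
    have h2 := h.abs_estError_le hn hρ hm hω (f θ - f ⟨y, hsΘ hy⟩)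
    have h3 : (B / ρ + 1) * ‖f θ - f ⟨y, hsΘ hy⟩‖ ≤ c * ε / 2 := by
      calc _ ≤ (B / ρ + 1) * (ℓ * (κ * q)) := by
            refine mul_le_mul_of_nonneg_left ((hf _ _).trans ?_) (by positivity)
            exact mul_le_mul_of_nonneg_left hθy hℓ.le
        _ = c * q / 2 := by rw [hκ]; field_simp
        _ ≤ c * ε / 2 := by
          have := mul_le_mul_of_nonneg_left (min_le_left ε 1) hc.le
          linarith
    rw [map_sub] at h2
    have h4 := abs_sub_abs_le_abs_sub (estError K (S ω) (f θ)) (estError K (S ω) (f ⟨y, hsΘ hy⟩))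
    linarith
  have hpt : ∀ y ∈ s.attach, P.real {ω | c * ε / 2 ≤ |estError K (S ω) (f ⟨y, hsΘ y.2⟩)|} ≤
      2 * Real.exp (-((c * ε / 2) ^ 2 / (4 * V))) := by
    intro y _
    have hy1 := (h.pos_of_accuracy hc hε ⟨_, rfl⟩ (hεF (f ⟨y, hsΘ y.2⟩) ⟨_, rfl⟩)).2.2
    refine h.prob_estError_ge_le hn hρ hm hV (h.variance_le _ ⟨_, rfl⟩) (by positivity) ?_
    calc c * ε / 2 * ‖f ⟨y, hsΘ y.2⟩‖ ≤
          c * ε / 2 * (4 * ρ * expectedSize P S * V / (3 * c * ε)) :=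
          mul_le_mul_of_nonneg_left hy1 (by positivity)
      _ = 2 / 3 * (V * (ρ * expectedSize P S)) := by field_simp; ring
      _ ≤ _ := by
        have : 0 ≤ V * (ρ * expectedSize P S) := by positivity
        linarith
  have hcard' : (s.card : ℝ) ≤
      Real.exp (Real.log (1 + 2 * R / κ) * D - D * Real.log q) := by
    have e : Real.log (1 + 2 * R / κ) * D - D * Real.log q =
        D * Real.log ((1 + 2 * R / κ) / q) := by
      rw [Real.log_div (by positivity) hq0.ne']; ring
    rw [e, Real.exp_nat_mul, Real.exp_log (by positivity)]
    refine hcard.trans (pow_le_pow_left₀ (by positivity) ?_ _)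
    rw [add_div, ← div_div]
    -- The cap at `1` is what gives `1 + 2R/(κ q) ≤ (1 + 2R/κ)/q`, separating `C` from `log q`.
    have : 1 ≤ 1 / q := (one_le_div hq0).2 (min_le_right _ _)
    linarith
  calc P.real (badEvent S K (Set.range f) ε) ≤ _ :=
      ENNReal.toReal_mono (measure_ne_top _ _) (measure_mono_ae hsub)
    _ ≤ ∑ y ∈ s.attach, P.real {ω | c * ε / 2 ≤ |estError K (S ω) (f ⟨y, hsΘ y.2⟩)|} :=
      measureReal_biUnion_finset_le _ _
    _ ≤ ∑ _y ∈ s.attach, 2 * Real.exp (-((c * ε / 2) ^ 2 / (4 * V))) := Finset.sum_le_sum hpt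
    _ = s.card * (2 * Real.exp (-((c * ε / 2) ^ 2 / (4 * V)))) := by
      rw [Finset.sum_const, nsmul_eq_mul, Finset.card_attach]
    _ ≤ Real.exp (Real.log (1 + 2 * R / κ) * D - D * Real.log q) *
        (2 * Real.exp (-((c * ε / 2) ^ 2 / (4 * V)))) :=
      mul_le_mul_of_nonneg_right hcard' (by positivity)
    _ = _ := by
      rw [sub_eq_add_neg _ (c ^ 2 * ε ^ 2 / (16 * 1 * V)), Real.exp_add]
      have : (c * ε / 2) ^ 2 / (4 * V) = c ^ 2 * ε ^ 2 / (16 * 1 * V) := by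
        field_simp; ring
      rw [this]; ring

end Coreset

end DPPCoreset
/-- `‖f‖` is the sup norm on `Fin n → ℝ`, and it is positive on `F` because `n⁻¹ |L(f)| ≥ c > 0`;
the condition `∀ f ∈ F, ε ≤ 4 A ρ m V / (3 c ‖f‖)` says `ε ≤ 4 A ρ m V / (3 c sup_{f ∈ F} ‖f‖)`,
with no convention needed when the supremum is infinite. -/
theorem theorem4 :
    ∃ A : ℝ, 0 < A ∧
      -- queries spanning a space of dimension `D`
      (∀ (ρ c V : ℝ), 0 < ρ → 0 < c →
        ∀ (n : ℕ) (Ω : Type*) [MeasurableSpace Ω] (P : MeasureTheory.Measure Ω)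
          [MeasureTheory.IsProbabilityMeasure P] (S : Ω → Finset (Fin n))
          (K : Matrix (Fin n) (Fin n) ℂ) (F : Set (Fin n → ℝ)) (D : ℕ),
          DPPCoreset.Setting P S K F ρ c V →
          Module.finrank ℝ (Submodule.span ℝ F) = D →
          ∀ ε : ℝ, 0 ≤ ε →
            (∀ f ∈ F, ε ≤ 4 * A * ρ * DPPCoreset.expectedSize P S * V / (3 * c * ‖f‖)) →
            P.real (DPPCoreset.badEvent S K F ε) ≤
              2 * Real.exp (6 * D - c ^ 2 * ε ^ 2 / (16 * A * V))) ∧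
      -- queries with a Lipschitz parametrization by a bounded subset of `ℝ^D`
      (∀ (D : ℕ) (Θ : Set (EuclideanSpace ℝ (Fin D))), Bornology.IsBounded Θ →
        ∀ (B ρ ℓ c : ℝ), 0 < B → 0 < ρ → 0 < ℓ → 0 < c →
        ∃ C : ℝ, 0 < C ∧
          ∀ (V : ℝ) (n : ℕ) (Ω : Type*) [MeasurableSpace Ω] (P : MeasureTheory.Measure Ω)
            [MeasureTheory.IsProbabilityMeasure P] (S : Ω → Finset (Fin n))
            (K : Matrix (Fin n) (Fin n) ℂ) (f : Θ → Fin n → ℝ),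
            DPPCoreset.Setting P S K (Set.range f) ρ c V →
            (∀ θ θ' : Θ, ‖f θ - f θ'‖ ≤
              ℓ * ‖(θ : EuclideanSpace ℝ (Fin D)) - (θ' : EuclideanSpace ℝ (Fin D))‖) →
            (∀ᵐ ω ∂P, ((S ω).card : ℝ) ≤ B * DPPCoreset.expectedSize P S) →
            ∀ ε : ℝ, 0 ≤ ε →
              (∀ g ∈ Set.range f,
                ε ≤ 4 * A * ρ * DPPCoreset.expectedSize P S * V / (3 * c * ‖g‖)) →
              P.real (DPPCoreset.badEvent S K (Set.range f) ε) ≤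
                2 * Real.exp (C * D - D * Real.log (min ε 1) - c ^ 2 * ε ^ 2 / (16 * A * V))) := by
  -- `A = 1` because the tail exponent `a²/(4V)` at `a = cε/2` is `c²ε²/(16V)`.
  refine ⟨1, one_pos, ?_, ?_⟩
  · intro ρ c V hρ hc n Ω _ P _ S K F D h hD ε hε hεF
    rw [← hD]
    exact h.prob_badEvent_le_of_finrank hρ hc hε hεF
  · intro D Θ hΘ B ρ ℓ c hB hρ hℓ hc
    obtain ⟨R, hR, hΘR⟩ := hΘ.exists_pos_norm_le
    refine ⟨Real.log (1 + 2 * R / (c / (2 * ℓ * (B / ρ + 1)))), Real.log_pos ?_, ?_⟩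
    · have : 0 < 2 * R / (c / (2 * ℓ * (B / ρ + 1))) := by positivity
      linarith
    · intro V n Ω _ P _ S K f h hf hS ε hε hεF
      exact DPPCoreset.prob_badEvent_le_of_lipschitz h hR hΘR hB hρ hℓ hc hf hS hε hεF
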